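/- Let $\mathsf A$ be an abelian category. For a class of objects $\mathsf X$ put $\mathsf X^\perp=\{M : \mathrm{Ext}^1(X,M)=0 \text{ for all } X\in\mathsf X\}$ and ${}^\perp\mathsf X=\{M : \mathrm{Ext}^1(M,X)=0 \text{ for all } X\in\mathsf X\}$. A pair $(\mathsf X,\mathsf Y)$ of full subcategories is a \emph{cotorsion pair} if $\mathsf X^\perp=\mathsf Y$ and ${}^\perp\mathsf Y=\mathsf X$; it is \emph{complete} if moreover every object $M$ admits an epimorphism $X\to M$ with $X\in\mathsf X$ and kernel in $\mathsf X^\perp$, and a monomorphism $M\to Y$ with $Y\in\mathsf Y$ and cokernel in ${}^\perp\mathsf Y$. Let $Q$ be a (small) quiver with vertex set $Q_0$. Define subsets $V_\alpha\subseteq Q_0$ by transfinite recursion: $V_0=\emptyset$; $V_{\alpha+1}$ is the set of vertices that are not the target of any arrow with source outside $\bigcup_{\beta\le\alpha}V_\beta$; and $V_\alpha=\bigcup_{\beta<\alpha}V_\beta$ for limit ordinals $\alpha$. The quiver $Q$ is \emph{left rooted} if $V_\lambda=Q_0$ for some ordinal $\lambda$, and \emph{right rooted} if the opposite quiver $Q^{\mathrm{op}}$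 is left rooted. Let $\mathrm{Rep}(Q,\mathsf A)$ be the abelian category of $\mathsf A$-valued representations of $Q$, and for a subcategory $\mathsf X$ of $\mathsf A$ let $\mathrm{Rep}(Q,\mathsf X)$ consist of the representations $F$ with $F(i)\in\mathsf X$ for all $i\in Q_0$. When $\mathsf A$ has small coproducts, let $\varphi_i^F:\bigoplus_{a:\,j\to i}F(j)\to F(i)$ be the morphism induced by the $F(a)$, over all arrows $a$ with target $i$, and let $\Phi(\mathsf X)$ consist of the representations $F$ such that, for every vertex $i$, $\varphi_i^F$ is a monomorphism with cokernel in $\mathsf X$. Dually, when $\mathsf A$ has small products, let $\psi_i^F:F(i)\to\prod_{a:\,i\to j}F(j)$ be the induced morphism, over all arrows $a$ with source $i$, and let $\Psi(\mathsf X)$ consist of the representations $F$ such that, for every vertex $i$, $\psi_i^F$ is an epimorphism with kernel in $\mathsf X$. Let $(\mathsf X,\mathsf Y)$ be a complete cotorsion pair in $\mathsf A$. (a) If $Q$ is left rooted and $\mathsf A$ satisfies AB4 (small coproducts exist and are exact), then $(\Phi(\mathsf X),\mathrm{Rep}(Q,\mathsf Y))$ is a complete cotorsion pair in $\mathrm{Rep}(Q,\mathsf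 A)$. (b) If $Q$ is right rooted and $\mathsf A$ satisfies AB4* (small products exist and are exact), then $(\mathrm{Rep}(Q,\mathsf X),\Psi(\mathsf Y))$ is a complete cotorsion pair in $\mathrm{Rep}(Q,\mathsf A)$. -/

import Mathlib

open CategoryTheory CategoryTheory.Limits

universe w v u

noncomputable section

namespace QuiverCotorsion

/-! ### Cotorsion pairs in an abelian category -/

section Cotorsion

variable {C : Type u} [Category.{v} C] [Abelian C]

/-- `Ext¹(M, N) = 0`. The `Ext`-groups are taken in a universe in which they always exist, so that
no smallness condition on `C` is needed. -/
def ExtOneVanishes (M N : C) : Prop :=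
  haveI : HasExt.{max u v} C := HasExt.standard C
  Subsingleton (Abelian.Ext.{max u v} M N 1)

/-- `X^⊥`: the objects `M` with `Ext¹(P, M) = 0` for all `P` in `X`. -/
def rightPerp (X : ObjectProperty C) : ObjectProperty C :=
  fun M => ∀ P : C, X P → ExtOneVanishes P M

/-- `^⊥X`: the objects `M` with `Ext¹(M, P) = 0` for all `P` in `X`. -/
def leftPerp (X : ObjectProperty C) : ObjectProperty C :=
  fun M => ∀ P : C, X P → ExtOneVanishes M P

/-- `(X, Y)` is a cotorsion pair: `X^⊥ = Y` and `^⊥Y = X`. These equalities force both classes to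
be closed under isomorphisms, to contain the zero objects and to be closed under finite direct
sums, i.e. to be full additive subcategories closed under isomorphisms. -/
structure IsCotorsionPair (X Y : ObjectProperty C) : Prop where
  rightPerp_eq : rightPerp X = Y
  leftPerp_eq : leftPerp Y = X

/-- `f : P ⟶ M` is a special `X`-precover of `M`. -/
structure IsSpecialPrecover (X : ObjectProperty C) {P M : C} (f : P ⟶ M) : Prop where
  epi : Epi f
  mem : X P
  kernel_mem : rightPerp X (kernel f)

/-- `g : M ⟶ P` is a special `X`-preenvelope of `M`. -/
structure IsSpecialPreenvelope (X : ObjectProperty C) {M P : C} (g : M ⟶ P) : Prop where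
  mono : Mono g
  mem : X P
  cokernel_mem : leftPerp X (cokernel g)

/-- Every object has a special `X`-precover. -/
def IsSpecialPrecovering (X : ObjectProperty C) : Prop :=
  ∀ M : C, ∃ (P : C) (f : P ⟶ M), IsSpecialPrecover X f

/-- Every object has a special `X`-preenvelope. -/
def IsSpecialPreenveloping (X : ObjectProperty C) : Prop :=
  ∀ M : C, ∃ (P : C) (g : M ⟶ P), IsSpecialPreenvelope X g

/-- A complete cotorsion pair: a cotorsion pair `(X, Y)` such that every object has a special
`X`-precover and a special `Y`-preenvelope. -/
structure IsCompleteCotorsionPair (X Y : ObjectProperty C) : Prop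
    extends IsCotorsionPair X Y where
  enough_projectives : IsSpecialPrecovering X
  enough_injectives : IsSpecialPreenveloping Y

end Cotorsion

/-! ### Rooted quivers -/

section Rooted

variable (Q : Type w) [Quiver.{w} Q]

/-- The transfinite sequence of sets of vertices `V_α`: `V_0 = ∅`; `V_{α+1}` consists of the
vertices `i` that are not the target of any arrow whose source lies outside `⋃_{β ≤ α} V_β`; and
`V_α = ⋃_{β < α} V_β` for a limit ordinal `α`. See `rootedSeq_zero`, `rootedSeq_succ` and
`rootedSeq_limit`. -/
def rootedSeq (α : Ordinal.{w}) : Set Q :=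
  {i | (Order.IsSuccLimit α ∧ ∃ β : Set.Iio α, i ∈ rootedSeq β.1) ∨
    (¬ Order.IsSuccLimit α ∧ α ≠ 0 ∧
      ∀ (j : Q) (_ : j ⟶ i), ∃ β : Set.Iio α, j ∈ rootedSeq β.1)}
termination_by α
decreasing_by all_goals exact β.2

theorem rootedSeq_zero : rootedSeq Q 0 = ∅ := by
  rw [rootedSeq]
  ext i
  simp

theorem rootedSeq_succ (α : Ordinal.{w}) :
    rootedSeq Q (Order.succ α) =
      {i | ¬ ∃ (j : Q) (_ : j ⟶ i), j ∉ ⋃ β ∈ Set.Iic α, rootedSeq Q β} := by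
  rw [rootedSeq]
  ext i
  simp

theorem rootedSeq_limit (α : Ordinal.{w}) (h : Order.IsSuccLimit α) :
    rootedSeq Q α = ⋃ β ∈ Set.Iio α, rootedSeq Q β := by
  rw [rootedSeq]
  ext i
  simp [h]

/-- `Q` is left rooted: some `V_λ` is the set of all vertices. -/
def IsLeftRooted : Prop :=
  ∃ l : Ordinal.{w}, rootedSeq Q l = Set.univ

/-- `Q` is right rooted: the opposite quiver is left rooted. -/
def IsRightRooted : Prop :=
  IsLeftRooted Qᵒᵖ

end Rooted

/-! ### Representations of quivers -/

section Representations

variable (Q : Type w) [Quiver.{w} Q] (A : Type u) [Category.{v} A]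

/-- The category of `A`-valued representations of `Q`: functors from the free category on `Q`
to `A`. -/
abbrev Rep := Paths Q ⥤ A

variable {Q A}

/-- The object `F(i)` of `A` at the vertex `i`. -/
abbrev Rep.at (F : Rep Q A) (i : Q) : A := F.obj ((Paths.of Q).obj i)

/-- The morphism `F(a) : F(i) ⟶ F(j)` given by an arrow `a : i ⟶ j`. -/
abbrev Rep.arrow (F : Rep Q A) {i j : Q} (a : i ⟶ j) : F.at i ⟶ F.at j :=
  F.map ((Paths.of Q).map a)

/-- `Rep(Q, X)`: the representations with all values in `X`. -/
def repIn (Q : Type w) [Quiver.{w} Q] (X : ObjectProperty A) : ObjectProperty (Rep Q A) :=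
  fun F => ∀ i : Q, X (F.at i)

/-- `φ_i : ∐_{a : j ⟶ i} F(j) ⟶ F(i)`, the coproduct being over all arrows with target `i`. -/
def phi [HasCoproducts.{w} A] (F : Rep Q A) (i : Q) :
    (∐ fun a : Quiver.Costar i => F.at a.1) ⟶ F.at i :=
  Sigma.desc fun a => F.arrow a.2

/-- `ψ_i : F(i) ⟶ ∏_{a : i ⟶ j} F(j)`, the product being over all arrows with source `i`. -/
def psi [HasProducts.{w} A] (F : Rep Q A) (i : Q) :
    F.at i ⟶ (∏ᶜ fun a : Quiver.Star i => F.at a.1) :=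
  Pi.lift fun a => F.arrow a.2

variable [Abelian A]

/-- `Φ(X)`: the representations `F` such that, for all vertices `i`, `φ_i` is a monomorphism whose
cokernel belongs to `X`. -/
def Phi (Q : Type w) [Quiver.{w} Q] [HasCoproducts.{w} A] (X : ObjectProperty A) :
    ObjectProperty (Rep Q A) :=
  fun F => ∀ i : Q, Mono (phi F i) ∧ X (cokernel (phi F i))

/-- `Ψ(Y)`: the representations `F` such that, for all vertices `i`, `ψ_i` is an epimorphism whose
kernel belongs to `Y`. -/
def Psi (Q : Type w) [Quiver.{w} Q] [HasProducts.{w} A] (Y : ObjectProperty A) :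
    ObjectProperty (Rep Q A) :=
  fun F => ∀ i : Q, Epi (psi F i) ∧ Y (kernel (psi F i))

end Representations

end QuiverCotorsion

end

/-!
The idea is Hovey's correspondence: `(X, Y)` is a complete cotorsion pair exactly when the
monomorphisms with cokernel in `X` and the epimorphisms with kernel in `Y` form a weak factorization
system. For short exact sequences `S` and `T`, the vanishing of `Ext¹(S.X₃, T.X₁)` gives the lifting
property of `S.f` against `T.g`; factorizations come from a pushout of a special preenvelope.

If `Q` is left rooted, the existence of an arrow `j ⟶ i` is a well-founded relation on the vertices.
A weak factorization system `(L, R)` on `A` then induces one on representations, as for Reedy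
categories: lifts and factorizations are built one vertex at a time. Its right class consists of
the morphisms that are in `R` at all vertices, its left class of those `η : F ⟶ G` whose relative
latching maps `F(i) ⨿_{∐ F(j)} ∐ G(j) ⟶ G(i)` belong to `L`. For the system given by `(X, Y)` the
right class consists of the epimorphisms with kernel in `Rep(Q, Y)`, exactness of coproducts forces
the left class to consist of monomorphisms, and the relative latching maps of `0 ⟶ F` are, up to
isomorphism, the maps `φ_i`, so the induced cotorsion pair is `(Φ(X), Rep(Q, Y))`.

The second half is dual, through the equivalence of `Rep(Q, A)` with the opposite of
`Rep(Qᵒᵖ, Aᵒᵖ)`.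
-/

noncomputable section

namespace QuiverCotorsion

/-! ### `Ext¹` and lifting properties -/

section ExtOne

open DerivedCategory Pretriangulated

variable {C : Type u} [Category.{v} C] [Abelian C]

lemma shortExact_of_singleFunctor_distTriang [HasDerivedCategory.{w} C] {S : ShortComplex C}
    {h : (singleFunctor C 0).obj S.X₃ ⟶ ((singleFunctor C 0).obj S.X₁)⟦(1 : ℤ)⟧}
    (hT : Triangle.mk ((singleFunctor C 0).map S.f) ((singleFunctor C 0).map S.g) h ∈
      distTriang (DerivedCategory C)) : S.ShortExact := by
  have hS : (S.map (singleFunctor C 0 ⋙ homologyFunctor C 0)).ShortExact :=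
    { exact := HomologySequence.exact₂ _ hT 0
      mono_f := (HomologySequence.mono_homologyMap_mor₁_iff _ hT (-1) 0).2
        ((isZero_of_isGE ((singleFunctor C 0).obj S.X₃) 0 (-1) (by lia)).eq_of_src _ _)
      epi_g := (HomologySequence.epi_homologyMap_mor₂_iff _ hT 0 1).2
        ((isZero_of_isLE ((singleFunctor C 0).obj S.X₁) 0 1 (by lia)).eq_of_tgt _ _) }
  exact ShortComplex.shortExact_of_iso (S.mapNatIso (singleFunctorCompHomologyFunctorIso C 0)) hS

/-- `E` is the fibre of `ξ : M ⟶ N⟦1⟧`, which lies in the heart of the canonical t-structure. -/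
lemma exists_shortExact_mk₀_comp_eq_zero [HasExt.{w} C] {M N : C} (ξ : Abelian.Ext.{w} M N 1) :
    ∃ (E : C) (i : N ⟶ E) (p : E ⟶ M) (zero : i ≫ p = 0),
      (ShortComplex.mk i p zero).ShortExact ∧
        (Abelian.Ext.mk₀ p).comp ξ (zero_add 1) = 0 := by
  let := HasDerivedCategory.standard C
  let ι := singleFunctor C 0
  obtain ⟨Z, f, g, hZ⟩ := distinguished_cocone_triangle₂ ξ.hom
  have : Z.IsLE 0 := TStructure.t.isLE₂ _ hZ 0
    (inferInstanceAs ((ι.obj N).IsLE 0)) (inferInstanceAs ((ι.obj M).IsLE 0))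
  have : Z.IsGE 0 := TStructure.t.isGE₂ _ hZ 0
    (inferInstanceAs ((ι.obj N).IsGE 0)) (inferInstanceAs ((ι.obj M).IsGE 0))
  obtain ⟨E, ⟨e⟩⟩ := exists_iso_singleFunctor_obj_of_isGE_of_isLE Z 0
  obtain ⟨i, hi⟩ := ι.map_surjective (f ≫ e.hom)
  obtain ⟨p, hp⟩ := ι.map_surjective (e.inv ≫ g)
  have hE : Triangle.mk (ι.map i) (ι.map p) ξ.hom ∈ distTriang (DerivedCategory C) :=
    isomorphic_distinguished _ hZ _
      (Triangle.isoMk _ _ (Iso.refl (ι.obj N)) e.symm (Iso.refl (ι.obj M))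
        (by simp [Triangle.mk, hi]) (by simp [Triangle.mk, hp]) (by simp [Triangle.mk]))
  have zero : i ≫ p = 0 := ι.map_injective <| by
    rw [ι.map_comp, ι.map_zero]
    exact comp_distTriang_mor_zero₁₂ _ hE
  refine ⟨E, i, p, zero, shortExact_of_singleFunctor_distTriang hE, ?_⟩
  ext
  rw [Abelian.Ext.comp_hom, Abelian.Ext.mk₀_hom, ShiftedHom.mk₀_comp, Abelian.Ext.zero_hom]
  exact comp_distTriang_mor_zero₂₃ _ hE

lemma extOneVanishes_of_forall_exists_section {M N : C}
    (h : ∀ (E : C) (i : N ⟶ E) (p : E ⟶ M) (zero : i ≫ p = 0),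
      (ShortComplex.mk i p zero).ShortExact → ∃ s : M ⟶ E, s ≫ p = 𝟙 M) :
    ExtOneVanishes M N := by
  have : HasExt.{max u v} C := HasExt.standard C
  refine subsingleton_of_forall_eq 0 fun ξ => ?_
  obtain ⟨E, i, p, zero, hE, hξ⟩ := exists_shortExact_mk₀_comp_eq_zero ξ
  obtain ⟨s, hs⟩ := h E i p zero hE
  rw [← Abelian.Ext.mk₀_id_comp ξ, ← hs, ← Abelian.Ext.mk₀_comp_mk₀_assoc, hξ,
    Abelian.Ext.comp_zero]

lemma extOneVanishes_of_forall_exists_retraction {M N : C}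
    (h : ∀ (E : C) (i : N ⟶ E) (p : E ⟶ M) (zero : i ≫ p = 0),
      (ShortComplex.mk i p zero).ShortExact → ∃ r : E ⟶ N, i ≫ r = 𝟙 N) :
    ExtOneVanishes M N :=
  extOneVanishes_of_forall_exists_section fun E i p zero hE => by
    obtain ⟨r, hr⟩ := h E i p zero hE
    exact ⟨_, (ShortComplex.Splitting.ofExactOfRetraction _ hE.exact r hr hE.epi_g).s_g⟩

lemma ExtOneVanishes.exists_extension {S : ShortComplex C} (hS : S.ShortExact) {N : C}
    (h : ExtOneVanishes S.X₃ N) (f : S.X₁ ⟶ N) : ∃ g : S.X₂ ⟶ N, S.f ≫ g = f := by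
  have : HasExt.{max u v} C := HasExt.standard C
  have : Subsingleton (Abelian.Ext.{max u v} S.X₃ N 1) := h
  obtain ⟨x, hx⟩ := Abelian.Ext.contravariant_sequence_exact₁ hS N (Abelian.Ext.mk₀ f)
    (add_zero 1) (Subsingleton.elim _ _)
  obtain ⟨g, rfl⟩ := (Abelian.Ext.mk₀_bijective _ _).2 x
  rw [Abelian.Ext.mk₀_comp_mk₀] at hx
  exact ⟨g, (Abelian.Ext.mk₀_bijective _ _).1 hx⟩

/-- The obstruction to lifting `b` along `T.g` restricts to `0` on `S.X₁`, hence comes from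
`Ext¹(S.X₃, T.X₁) = 0`. -/
lemma ExtOneVanishes.exists_lift {S T : ShortComplex C} (hS : S.ShortExact) (hT : T.ShortExact)
    (h : ExtOneVanishes S.X₃ T.X₁) {a : S.X₁ ⟶ T.X₂} {b : S.X₂ ⟶ T.X₃}
    (sq : CommSq a S.f T.g b) : ∃ l : S.X₂ ⟶ T.X₂, l ≫ T.g = b := by
  have : HasExt.{max u v} C := HasExt.standard C
  have : Subsingleton (Abelian.Ext.{max u v} S.X₃ T.X₁ 1) := h
  have restrict_eq_zero : (Abelian.Ext.mk₀ S.f).comp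
      ((Abelian.Ext.mk₀ b).comp hT.extClass (zero_add 1)) (zero_add 1) = 0 := by
    rw [Abelian.Ext.mk₀_comp_mk₀_assoc, ← sq.w, ← Abelian.Ext.mk₀_comp_mk₀_assoc,
      hT.comp_extClass, Abelian.Ext.comp_zero]
  obtain ⟨x, hx⟩ := Abelian.Ext.contravariant_sequence_exact₂ hS _ _ restrict_eq_zero
  rw [Subsingleton.elim x 0, Abelian.Ext.comp_zero] at hx
  obtain ⟨y, hy⟩ := Abelian.Ext.covariant_sequence_exact₃ _ hT _ (zero_add 1) hx.symm
  obtain ⟨l, rfl⟩ := (Abelian.Ext.mk₀_bijective _ _).2 y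
  rw [Abelian.Ext.mk₀_comp_mk₀] at hy
  exact ⟨l, (Abelian.Ext.mk₀_bijective _ _).1 hy⟩

lemma ExtOneVanishes.hasLiftingProperty {S T : ShortComplex C} (hS : S.ShortExact)
    (hT : T.ShortExact) (h : ExtOneVanishes S.X₃ T.X₁) : HasLiftingProperty S.f T.g where
  sq_hasLift {a b} sq := by
    have := hT.mono_f
    obtain ⟨l, hl⟩ := h.exists_lift hS hT sq
    have defect_comp : (a - S.f ≫ l) ≫ T.g = 0 := by
      rw [Preadditive.sub_comp, Category.assoc, hl, sq.w, sub_self]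
    obtain ⟨d, hd⟩ := h.exists_extension hS (hT.exact.lift _ defect_comp)
    exact ⟨⟨{
      l := l + d ≫ T.f
      fac_left := by rw [Preadditive.comp_add, reassoc_of% hd, hT.exact.lift_f, add_sub_cancel]
      fac_right := by rw [Preadditive.add_comp, Category.assoc, T.zero, comp_zero, add_zero, hl] }⟩⟩

instance (X : ObjectProperty C) : (leftPerp X).IsClosedUnderIsomorphisms where
  of_iso {M M'} e hM P hP := by
    have : HasExt.{max u v} C := HasExt.standard C
    let extIso := ((Abelian.extFunctor 1).mapIso e.op).app P
    exact extIso.addCommGroupIsoToAddEquiv.subsingleton_congr.2 (hM P hP)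

instance (X : ObjectProperty C) : (rightPerp X).IsClosedUnderIsomorphisms where
  of_iso {N N'} e hN P hP := by
    have : HasExt.{max u v} C := HasExt.standard C
    exact ((Abelian.extFunctorObj P 1).mapIso e).addCommGroupIsoToAddEquiv.subsingleton_congr.1
      (hN P hP)

end ExtOne

/-! ### Complete cotorsion pairs and weak factorization systems -/

section Hovey

open ZeroObject

variable {C : Type u} [Category.{v} C] [Abelian C] {X Y : ObjectProperty C}

/-- The monomorphisms with cokernel in `X`: the left class of the weak factorization system that
corresponds to a complete cotorsion pair `(X, Y)`. -/
def monoWithCokernel (X : ObjectProperty C) : MorphismProperty C :=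
  fun _ _ f => Mono f ∧ X (cokernel f)

/-- The epimorphisms with kernel in `Y`: the right class of the weak factorization system that
corresponds to a complete cotorsion pair `(X, Y)`. -/
def epiWithKernel (Y : ObjectProperty C) : MorphismProperty C :=
  fun _ _ g => Epi g ∧ Y (kernel g)

lemma shortExact_cokernel {M N : C} (f : M ⟶ N) [Mono f] :
    (ShortComplex.mk f (cokernel.π f) (cokernel.condition f)).ShortExact where
  exact := ShortComplex.exact_cokernel f

lemma shortExact_kernel {M N : C} (g : M ⟶ N) [Epi g] :
    (ShortComplex.mk (kernel.ι g) g (kernel.condition g)).ShortExact where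
  exact := ShortComplex.exact_kernel g

lemma shortExact_zero_id (M : C) :
    (ShortComplex.mk (0 : 0 ⟶ M) (𝟙 M) zero_comp).ShortExact where
  exact := (ShortComplex.exact_iff_mono _ rfl).2 (inferInstanceAs (Mono (𝟙 M)))
  mono_f := inferInstance

lemma shortExact_id_zero (M : C) :
    (ShortComplex.mk (𝟙 M) (0 : M ⟶ 0) comp_zero).ShortExact where
  exact := (ShortComplex.exact_iff_epi _ rfl).2 (inferInstanceAs (Epi (𝟙 M)))
  epi_g := inferInstance

lemma shortExact_of_isPushout {S : ShortComplex C} (hS : S.ShortExact) {N E : C}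
    {k : S.X₁ ⟶ N} {q : S.X₂ ⟶ E} {i : N ⟶ E} (sq : IsPushout S.f k q i) {p : E ⟶ S.X₃}
    (hq : q ≫ p = S.g) (zero : i ≫ p = 0) : (ShortComplex.mk i p zero).ShortExact := by
  have := hS.mono_f
  have := hS.epi_g
  have : Mono i := (MorphismProperty.monomorphisms C).of_isPushout sq.flip ‹Mono S.f›
  have : Epi p := epi_of_epi_fac hq
  refine ⟨ShortComplex.exact_of_g_is_cokernel _ <|
    CokernelCofork.IsColimit.ofπ' _ _ fun {T} t ht => ?_⟩
  have ht' : S.f ≫ q ≫ t = 0 := by rw [sq.w_assoc, ht, comp_zero]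
  refine ⟨hS.exact.desc _ ht', sq.hom_ext ?_ ?_⟩
  · rw [reassoc_of% hq, hS.exact.g_desc]
  · rw [reassoc_of% zero, zero_comp]
    exact ht.symm

lemma monoWithCokernel_f_iff [X.IsClosedUnderIsomorphisms] {S : ShortComplex C}
    (hS : S.ShortExact) : monoWithCokernel X S.f ↔ X S.X₃ :=
  (and_iff_right hS.mono_f).trans <| X.prop_iff_of_iso <|
    (cokernelIsCokernel S.f).coconePointUniqueUpToIso hS.gIsCokernel

lemma epiWithKernel_g_iff [Y.IsClosedUnderIsomorphisms] {S : ShortComplex C}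
    (hS : S.ShortExact) : epiWithKernel Y S.g ↔ Y S.X₁ :=
  (and_iff_right hS.epi_g).trans <| Y.prop_iff_of_iso <|
    (kernelIsKernel S.g).conePointUniqueUpToIso hS.fIsKernel

instance [X.IsClosedUnderIsomorphisms] : (monoWithCokernel X).RespectsIso :=
  .of_respects_arrow_iso _ fun f g e ⟨hf, h⟩ =>
    ⟨((MorphismProperty.monomorphisms C).arrow_iso_iff e).1 hf,
      X.prop_of_iso (cokernel.mapIso f.hom g.hom (Arrow.leftFunc.mapIso e)
        (Arrow.rightFunc.mapIso e) (Arrow.w e.hom).symm) h⟩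

lemma llp_epiWithKernel_f_iff [Y.IsClosedUnderIsomorphisms] {S : ShortComplex C}
    (hS : S.ShortExact) : (epiWithKernel Y).llp S.f ↔ leftPerp Y S.X₃ := by
  refine ⟨fun hf N hN => extOneVanishes_of_forall_exists_section fun E i p zero hE => ?_,
    fun h P Q g ⟨_, hg⟩ => (h _ hg).hasLiftingProperty hS (shortExact_kernel g)⟩
  have := hf p ((epiWithKernel_g_iff hE).2 hN)
  have := hS.epi_g
  have sq : CommSq 0 S.f p S.g := ⟨by simp⟩
  refine ⟨hS.exact.desc sq.lift sq.fac_left, ?_⟩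
  rw [← cancel_epi S.g, hS.exact.g_desc_assoc, sq.fac_right, Category.comp_id]

lemma rlp_monoWithCokernel_g_iff [X.IsClosedUnderIsomorphisms] {S : ShortComplex C}
    (hS : S.ShortExact) : (monoWithCokernel X).rlp S.g ↔ rightPerp X S.X₁ := by
  refine ⟨fun hg M hM => extOneVanishes_of_forall_exists_retraction fun E i p zero hE => ?_,
    fun h P Q f ⟨_, hf⟩ => (h _ hf).hasLiftingProperty (shortExact_cokernel f) hS⟩
  have := hg i ((monoWithCokernel_f_iff hE).2 hM)
  have := hS.mono_f
  have sq : CommSq S.f i S.g 0 := ⟨by simp⟩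
  refine ⟨hS.exact.lift sq.lift sq.fac_right, ?_⟩
  rw [← cancel_mono S.f, Category.assoc, hS.exact.lift_f, sq.fac_left, Category.id_comp]

namespace IsCompleteCotorsionPair

lemma isClosedUnderIsomorphisms_left (h : IsCompleteCotorsionPair X Y) :
    X.IsClosedUnderIsomorphisms :=
  h.leftPerp_eq ▸ inferInstance

lemma isClosedUnderIsomorphisms_right (h : IsCompleteCotorsionPair X Y) :
    Y.IsClosedUnderIsomorphisms :=
  h.rightPerp_eq ▸ inferInstance

lemma exists_monoWithCokernel (h : IsCompleteCotorsionPair X Y) (M : C) :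
    ∃ (J : C) (j : M ⟶ J), monoWithCokernel X j ∧ Y J := by
  obtain ⟨J, j, hj⟩ := h.enough_injectives M
  exact ⟨J, j, ⟨hj.mono, h.leftPerp_eq ▸ hj.cokernel_mem⟩, hj.mem⟩

lemma exists_epiWithKernel (h : IsCompleteCotorsionPair X Y) (M : C) :
    ∃ (P : C) (p : P ⟶ M), epiWithKernel Y p ∧ X P := by
  obtain ⟨P, p, hp⟩ := h.enough_projectives M
  exact ⟨P, p, ⟨hp.epi, h.rightPerp_eq ▸ hp.kernel_mem⟩, hp.mem⟩

lemma llp_epiWithKernel (h : IsCompleteCotorsionPair X Y) :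
    (epiWithKernel Y).llp = monoWithCokernel X := by
  have := h.isClosedUnderIsomorphisms_right
  ext M N f
  suffices hf : (epiWithKernel Y).llp f → Mono f by
    refine ⟨fun hl => ?_, fun ⟨_, hX⟩ => ?_⟩
    · have := hf hl
      exact ⟨this, h.leftPerp_eq ▸ (llp_epiWithKernel_f_iff (shortExact_cokernel f)).1 hl⟩
    · exact (llp_epiWithKernel_f_iff (shortExact_cokernel f)).2 (h.leftPerp_eq.symm ▸ hX)
  intro hl
  obtain ⟨J, j, ⟨_, -⟩, hJ⟩ := h.exists_monoWithCokernel M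
  have := hl (0 : J ⟶ 0) ((epiWithKernel_g_iff (shortExact_id_zero J)).2 hJ)
  have sq : CommSq j f (0 : J ⟶ 0) 0 := ⟨by simp⟩
  exact mono_of_mono_fac sq.fac_left

lemma rlp_monoWithCokernel (h : IsCompleteCotorsionPair X Y) :
    (monoWithCokernel X).rlp = epiWithKernel Y := by
  have := h.isClosedUnderIsomorphisms_left
  ext M N g
  suffices hg : (monoWithCokernel X).rlp g → Epi g by
    refine ⟨fun hr => ?_, fun ⟨_, hY⟩ => ?_⟩
    · have := hg hr
      exact ⟨this, h.rightPerp_eq ▸ (rlp_monoWithCokernel_g_iff (shortExact_kernel g)).1 hr⟩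
    · exact (rlp_monoWithCokernel_g_iff (shortExact_kernel g)).2 (h.rightPerp_eq.symm ▸ hY)
  intro hr
  obtain ⟨P, p, ⟨_, -⟩, hP⟩ := h.exists_epiWithKernel N
  have := hr (0 : 0 ⟶ P) ((monoWithCokernel_f_iff (shortExact_zero_id P)).2 hP)
  have sq : CommSq 0 (0 : 0 ⟶ P) g p := ⟨by simp⟩
  exact epi_of_epi_fac sq.fac_right

lemma nonempty_mapFactorizationData_of_epi (h : IsCompleteCotorsionPair X Y) {M N : C} (f : M ⟶ N)
    [Epi f] : Nonempty ((monoWithCokernel X).MapFactorizationData (epiWithKernel Y) f) := by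
  have := h.isClosedUnderIsomorphisms_right
  have : (monoWithCokernel X).IsStableUnderCobaseChange := h.llp_epiWithKernel ▸ inferInstance
  obtain ⟨J, j, hj, hJ⟩ := h.exists_monoWithCokernel (kernel f)
  have sq := IsPushout.of_hasPushout (kernel.ι f) j
  have w : kernel.ι f ≫ f = j ≫ 0 := by simp
  exact ⟨{ Z := pushout (kernel.ι f) j
           i := pushout.inl _ _
           p := sq.desc f 0 w
           hi := MorphismProperty.of_isPushout sq hj
           hp := (epiWithKernel_g_iff (shortExact_of_isPushout (shortExact_kernel f) sq
             (sq.inl_desc f 0 w) (sq.inr_desc f 0 w))).2 hJ }⟩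

lemma nonempty_mapFactorizationData (h : IsCompleteCotorsionPair X Y) {M N : C} (f : M ⟶ N) :
    Nonempty ((monoWithCokernel X).MapFactorizationData (epiWithKernel Y) f) := by
  have := h.isClosedUnderIsomorphisms_left
  have : (monoWithCokernel X).IsMultiplicative := h.llp_epiWithKernel ▸ inferInstance
  obtain ⟨P, p, ⟨_, -⟩, hP⟩ := h.exists_epiWithKernel N
  have : Epi (biprod.desc f p) := epi_of_epi_fac (biprod.inr_desc f p)
  obtain ⟨φ⟩ := h.nonempty_mapFactorizationData_of_epi (biprod.desc f p)
  have hinl : monoWithCokernel X (biprod.inl : M ⟶ M ⊞ P) :=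
    (monoWithCokernel_f_iff (ShortComplex.Splitting.ofHasBinaryBiproduct M P).shortExact).2 hP
  exact ⟨{ Z := φ.Z
           i := biprod.inl ≫ φ.i
           p := φ.p
           hi := MorphismProperty.comp_mem _ _ _ hinl φ.hi
           hp := φ.hp }⟩

theorem isWeakFactorizationSystem (h : IsCompleteCotorsionPair X Y) :
    (monoWithCokernel X).IsWeakFactorizationSystem (epiWithKernel Y) where
  rlp := h.rlp_monoWithCokernel
  llp := h.llp_epiWithKernel
  hasFactorization := ⟨h.nonempty_mapFactorizationData⟩

end IsCompleteCotorsionPair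

section

variable {L : MorphismProperty C} [Y.IsClosedUnderIsomorphisms]
  [L.IsWeakFactorizationSystem (epiWithKernel Y)]

lemma leftPerp_iff_of_isWeakFactorizationSystem (M : C) :
    leftPerp Y M ↔ L (0 : 0 ⟶ M) := by
  rw [← llp_epiWithKernel_f_iff (shortExact_zero_id M), MorphismProperty.llp_eq_of_wfs L]

lemma monoWithCokernel_leftPerp_eq (hL : L ≤ MorphismProperty.monomorphisms C) :
    monoWithCokernel (leftPerp Y) = L := by
  ext M N f
  have (_ : Mono f) : leftPerp Y (cokernel f) ↔ L f := by
    rw [← llp_epiWithKernel_f_iff (shortExact_cokernel f), MorphismProperty.llp_eq_of_wfs L]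
  exact ⟨fun ⟨hf, h⟩ => (this hf).1 h, fun h => ⟨hL f h, (this (hL f h)).2 h⟩⟩

lemma rightPerp_leftPerp_eq (hL : L ≤ MorphismProperty.monomorphisms C) :
    rightPerp (leftPerp Y) = Y := by
  ext N
  rw [← rlp_monoWithCokernel_g_iff (shortExact_id_zero N), monoWithCokernel_leftPerp_eq hL,
    MorphismProperty.rlp_eq_of_wfs L (epiWithKernel Y), epiWithKernel_g_iff (shortExact_id_zero N)]

theorem isCompleteCotorsionPair_leftPerp (hL : L ≤ MorphismProperty.monomorphisms C) :
    IsCompleteCotorsionPair (leftPerp Y) Y where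
  rightPerp_eq := rightPerp_leftPerp_eq hL
  leftPerp_eq := rfl
  enough_projectives M := by
    let φ := MorphismProperty.factorizationData L (epiWithKernel Y) (0 : 0 ⟶ M)
    have hi : L (0 : 0 ⟶ φ.Z) := (isZero_zero C).eq_of_src φ.i 0 ▸ φ.hi
    exact ⟨φ.Z, φ.p, φ.hp.1, (leftPerp_iff_of_isWeakFactorizationSystem φ.Z).2 hi,
      (rightPerp_leftPerp_eq hL).ge _ φ.hp.2⟩
  enough_injectives M := by
    let φ := MorphismProperty.factorizationData L (epiWithKernel Y) (0 : M ⟶ 0)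
    have hp : epiWithKernel Y (0 : φ.Z ⟶ 0) := (isZero_zero C).eq_of_tgt φ.p 0 ▸ φ.hp
    have hi : monoWithCokernel (leftPerp Y) φ.i := (monoWithCokernel_leftPerp_eq hL).ge _ φ.hi
    exact ⟨φ.Z, φ.i, hi.1, (epiWithKernel_g_iff (shortExact_id_zero φ.Z)).1 hp, hi.2⟩

end

variable (X Y) in
theorem isCompleteCotorsionPair_of_isWeakFactorizationSystem [X.IsClosedUnderIsomorphisms]
    [Y.IsClosedUnderIsomorphisms]
    [(monoWithCokernel X).IsWeakFactorizationSystem (epiWithKernel Y)] :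
    IsCompleteCotorsionPair X Y := by
  have : leftPerp Y = X := by
    ext M
    rw [leftPerp_iff_of_isWeakFactorizationSystem (L := monoWithCokernel X) M,
      monoWithCokernel_f_iff (shortExact_zero_id M)]
  exact this ▸ isCompleteCotorsionPair_leftPerp (L := monoWithCokernel X) fun _ _ _ h => h.1

end Hovey

section Rooted

variable (Q : Type w) [Quiver.{w} Q]

/-- The relation on vertices given by the existence of an arrow. -/
abbrev arrowRel (j i : Q) : Prop := Nonempty (j ⟶ i)

variable {Q}

lemma acc_arrowRel_of_mem_rootedSeq {α : Ordinal.{w}} {i : Q} (hi : i ∈ rootedSeq Q α) :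
    Acc (arrowRel Q) i := by
  induction α using WellFoundedLT.induction generalizing i with
  | ind α ih =>
    rw [rootedSeq] at hi
    rcases hi with ⟨_, β, hβ⟩ | ⟨_, _, hi⟩
    · exact ih β.1 β.2 hβ
    · refine Acc.intro i fun j ⟨a⟩ => ?_
      obtain ⟨β, hβ⟩ := hi j a
      exact ih β.1 β.2 hβ

lemma IsLeftRooted.wellFounded_arrowRel (h : IsLeftRooted Q) : WellFounded (arrowRel Q) :=
  ⟨fun i => have ⟨_, hl⟩ := h; acc_arrowRel_of_mem_rootedSeq (hl ▸ Set.mem_univ i)⟩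

lemma exists_forall_of_wellFounded {ι : Sort*} {r : ι → ι → Prop} (hr : WellFounded r)
    {D : ι → Sort*} {R : ∀ i, (∀ j, r j i → D j) → D i → Prop} (h : ∀ i d, ∃ x, R i d x) :
    ∃ d : ∀ i, D i, ∀ i, R i (fun j _ => d j) (d i) := by
  choose c hc using h
  refine ⟨hr.fix c, fun i => ?_⟩
  conv => arg 3; rw [hr.fix_eq]
  exact hc _ _

end Rooted

/-! ### Relative latching maps -/

section Latching

variable {Q : Type w} [Quiver.{w} Q] {A : Type u} [Category.{v} A]

/-- The component at a vertex of a morphism of representations. -/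
abbrev Rep.appAt {F G : Rep Q A} (η : F ⟶ G) (i : Q) : F.at i ⟶ G.at i :=
  η.app ((Paths.of Q).obj i)

lemma Rep.hom_ext {F G : Rep Q A} {η θ : F ⟶ G} (h : ∀ i, Rep.appAt η i = Rep.appAt θ i) :
    η = θ :=
  NatTrans.ext (funext h)

variable [HasCoproducts.{w} A]

lemma ι_phi (F : Rep Q A) {i : Q} (a : Quiver.Costar i) :
    Sigma.ι (fun a : Quiver.Costar i => F.at a.1) a ≫ phi F i = F.arrow a.2 :=
  Sigma.ι_desc _ _

lemma phi_comp_eq_iff {F : Rep Q A} {i : Q} {M : Quiver.Costar i → A} {N : A}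
    {l : ∀ a : Quiver.Costar i, F.at a.1 ⟶ M a} {m : ∀ a, M a ⟶ N} {x : F.at i ⟶ N} :
    phi F i ≫ x = Limits.Sigma.map l ≫ Sigma.desc m ↔
      ∀ a : Quiver.Costar i, F.arrow a.2 ≫ x = l a ≫ m a := by
  refine ⟨fun h a => ?_, fun h => Sigma.hom_ext _ _ fun a => ?_⟩
  · simpa [reassoc_of% ι_phi] using Sigma.ι _ a ≫= h
  · simpa [reassoc_of% ι_phi] using h a

/-- The coproduct of the components of `η` at the sources of the arrows with target `i`. -/
abbrev sigmaAt {F G : Rep Q A} (η : F ⟶ G) (i : Q) :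
    (∐ fun a : Quiver.Costar i => F.at a.1) ⟶ ∐ fun a : Quiver.Costar i => G.at a.1 :=
  Limits.Sigma.map fun a => Rep.appAt η a.1

lemma phi_naturality {F G : Rep Q A} (η : F ⟶ G) (i : Q) :
    phi F i ≫ Rep.appAt η i = sigmaAt η i ≫ phi G i :=
  phi_comp_eq_iff.2 fun _ => η.naturality _

lemma sigmaAt_comp {F G H : Rep Q A} (η : F ⟶ G) (θ : G ⟶ H) (i : Q) :
    sigmaAt (η ≫ θ) i = sigmaAt η i ≫ sigmaAt θ i :=
  Sigma.hom_ext _ _ fun a => by simp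

lemma sigmaAt_id (F : Rep Q A) (i : Q) : sigmaAt (𝟙 F) i = 𝟙 _ :=
  Sigma.hom_ext _ _ fun a => by simp

variable [HasPushouts A]

/-- The relative latching map at the vertex `i` of a morphism of representations. -/
def latchingMap {F G : Rep Q A} (η : F ⟶ G) (i : Q) :
    pushout (phi F i) (sigmaAt η i) ⟶ G.at i :=
  pushout.desc (Rep.appAt η i) (phi G i) (phi_naturality η i)

/-- The morphisms of representations all of whose relative latching maps belong to `L`. -/
def latching (L : MorphismProperty A) : MorphismProperty (Rep Q A) :=
  fun _ _ η => ∀ i, L (latchingMap η i)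

lemma inl_latchingMap {F G : Rep Q A} (η : F ⟶ G) (i : Q) :
    pushout.inl _ _ ≫ latchingMap η i = Rep.appAt η i :=
  pushout.inl_desc _ _ _

lemma inr_latchingMap {F G : Rep Q A} (η : F ⟶ G) (i : Q) :
    pushout.inr _ _ ≫ latchingMap η i = phi G i :=
  pushout.inr_desc _ _ _

lemma latchingMap_comp_eq_iff {F G : Rep Q A} {η : F ⟶ G} {i : Q} {N : A}
    {x : F.at i ⟶ N} {m : ∀ a : Quiver.Costar i, G.at a.1 ⟶ N}
    (comm : phi F i ≫ x = sigmaAt η i ≫ Sigma.desc m) {y : G.at i ⟶ N} :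
    latchingMap η i ≫ y = pushout.desc x (Sigma.desc m) comm ↔
      Rep.appAt η i ≫ y = x ∧ ∀ a : Quiver.Costar i, G.arrow a.2 ≫ y = m a := by
  rw [pushout.hom_ext_iff, reassoc_of% inl_latchingMap, reassoc_of% inr_latchingMap,
    pushout.inl_desc, pushout.inr_desc, Sigma.hom_ext_iff]
  simp only [reassoc_of% ι_phi, Sigma.ι_desc]

section

variable {F G F' G' F'' G'' : Rep Q A} {η : F ⟶ G} {η' : F' ⟶ G'} {η'' : F'' ⟶ G''}

/-- The morphism induced by a commutative square on the sources of the relative latching maps. -/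
def latchingObjMap {α : F ⟶ F'} {β : G ⟶ G'} (sq : α ≫ η' = η ≫ β) (i : Q) :
    pushout (phi F i) (sigmaAt η i) ⟶ pushout (phi F' i) (sigmaAt η' i) :=
  pushout.map _ _ _ _ (Rep.appAt α i) (sigmaAt β i) (sigmaAt α i) (phi_naturality α i)
    (by rw [← sigmaAt_comp, ← sigmaAt_comp, sq])

lemma latchingObjMap_comp_latchingMap {α : F ⟶ F'} {β : G ⟶ G'} (sq : α ≫ η' = η ≫ β) (i : Q) :
    latchingObjMap sq i ≫ latchingMap η' i = latchingMap η i ≫ Rep.appAt β i := by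
  apply pushout.hom_ext
  · rw [latchingObjMap, pushout.inl_desc_assoc, Category.assoc, inl_latchingMap,
      reassoc_of% inl_latchingMap]
    exact congr_app sq _
  · rw [latchingObjMap, pushout.inr_desc_assoc, Category.assoc, inr_latchingMap,
      reassoc_of% inr_latchingMap, phi_naturality]

lemma latchingObjMap_comp {α : F ⟶ F'} {β : G ⟶ G'} (sq : α ≫ η' = η ≫ β)
    {α' : F' ⟶ F''} {β' : G' ⟶ G''} (sq' : α' ≫ η'' = η' ≫ β')
    (sq'' : (α ≫ α') ≫ η'' = η ≫ β ≫ β') (i : Q) :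
    latchingObjMap sq'' i = latchingObjMap sq i ≫ latchingObjMap sq' i := by
  rw [latchingObjMap, latchingObjMap, latchingObjMap, pushout.map_comp]
  simp only [NatTrans.comp_app, sigmaAt_comp]

lemma latchingObjMap_id (sq : 𝟙 F ≫ η = η ≫ 𝟙 G) (i : Q) : latchingObjMap sq i = 𝟙 _ := by
  apply pushout.hom_ext <;> simp [latchingObjMap, sigmaAt_id]

end

/-- The relative latching map at `i` as a functor on morphisms. -/
def latchingFunctor (i : Q) : Arrow (Rep Q A) ⥤ Arrow A where
  obj η := Arrow.mk (latchingMap η.hom i)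
  map σ := Arrow.homMk (latchingObjMap (Arrow.w σ) i) (Rep.appAt σ.right i)
    (latchingObjMap_comp_latchingMap _ i)
  map_id η := Arrow.hom_ext _ _ (latchingObjMap_id (by simp) i) rfl
  map_comp σ τ := Arrow.hom_ext _ _
    (latchingObjMap_comp (Arrow.w σ) (Arrow.w τ) (Arrow.w (σ ≫ τ)) i) rfl

instance (L : MorphismProperty A) [L.IsStableUnderRetracts] :
    (latching (Q := Q) L).IsStableUnderRetracts where
  of_retract {_ _ _ _ f g} r h i :=
    have r' : RetractArrow (latchingMap f i) (latchingMap g i) := Retract.map r (latchingFunctor i)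
    L.of_retract r' (h i)

variable {L R : MorphismProperty A}

lemma exists_liftStruct_of_latchingMap {F G E B : Rep Q A} {η : F ⟶ G} {π : E ⟶ B} {t : F ⟶ E}
    {b : G ⟶ B} (sq : ∀ i, CommSq (Rep.appAt t i) (Rep.appAt η i) (Rep.appAt π i) (Rep.appAt b i))
    (i : Q) (d : ∀ a : Quiver.Costar i, (sq a.1).LiftStruct)
    [HasLiftingProperty (latchingMap η i) (Rep.appAt π i)] :
    ∃ x : (sq i).LiftStruct, ∀ a : Quiver.Costar i, G.arrow a.2 ≫ x.l = (d a).l ≫ E.arrow a.2 := by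
  have comm : phi F i ≫ Rep.appAt t i = sigmaAt η i ≫ Sigma.desc fun a => (d a).l ≫ E.arrow a.2 :=
    phi_comp_eq_iff.2 fun a => by rw [reassoc_of% (d a).fac_left, t.naturality]
  have sq' : CommSq (pushout.desc _ _ comm) (latchingMap η i) (Rep.appAt π i) (Rep.appAt b i) := by
    refine ⟨pushout.hom_ext ?_ (Sigma.hom_ext _ _ fun a => ?_)⟩
    · rw [pushout.inl_desc_assoc, reassoc_of% inl_latchingMap, (sq i).w]
    · rw [pushout.inr_desc_assoc, reassoc_of% inr_latchingMap, Sigma.ι_desc_assoc,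
        reassoc_of% ι_phi, Category.assoc, π.naturality, reassoc_of% (d a).fac_right, b.naturality]
  have ⟨fac_left, harrow⟩ := (latchingMap_comp_eq_iff comm).1 sq'.fac_left
  exact ⟨⟨sq'.lift, fac_left, sq'.fac_right⟩, harrow⟩

lemma hasLiftingProperty_of_latchingMap (hQ : WellFounded (arrowRel Q)) {F G E B : Rep Q A}
    {η : F ⟶ G} {π : E ⟶ B}
    (h : ∀ i, HasLiftingProperty (latchingMap η i) (Rep.appAt π i)) : HasLiftingProperty η π where
  sq_hasLift {t b} sq := by
    let sqAt (i : Q) : CommSq (Rep.appAt t i) (Rep.appAt η i) (Rep.appAt π i) (Rep.appAt b i) :=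
      sq.map ((evaluation (Paths Q) A).obj ((Paths.of Q).obj i))
    obtain ⟨d, hd⟩ := exists_forall_of_wellFounded hQ fun i d =>
      exists_liftStruct_of_latchingMap sqAt i fun a => d a.1 ⟨a.2⟩
    exact ⟨⟨{ l := Paths.liftNatTrans (fun i => (d i).l) fun a => hd _ ⟨_, a⟩
              fac_left := Rep.hom_ext fun i => (d i).fac_left
              fac_right := Rep.hom_ext fun i => (d i).fac_right }⟩⟩

/-- The factorizations of the component of `f` at `i` into an arbitrary morphism followed by a
morphism in `R`: the data out of which a factorization of `f` is built one vertex at a time. -/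
abbrev VertexFactorization {F G : Rep Q A} (R : MorphismProperty A) (f : F ⟶ G) (i : Q) :=
  (⊤ : MorphismProperty A).MapFactorizationData R (Rep.appAt f i)

lemma exists_vertexFactorization [L.HasFactorization R] {F G : Rep Q A} (f : F ⟶ G) (i : Q)
    (d : ∀ a : Quiver.Costar i, VertexFactorization R f a.1) :
    ∃ (x : VertexFactorization R f i) (m : ∀ a, (d a).Z ⟶ x.Z)
      (comm : phi F i ≫ x.i = (Limits.Sigma.map fun a => (d a).i) ≫ Sigma.desc m),
      L (pushout.desc x.i (Sigma.desc m) comm) ∧ ∀ a, m a ≫ x.p = (d a).p ≫ G.arrow a.2 := by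
  have comm : phi F i ≫ Rep.appAt f i =
      (Limits.Sigma.map fun a => (d a).i) ≫ Sigma.desc fun a => (d a).p ≫ G.arrow a.2 :=
    phi_comp_eq_iff.2 fun a => by rw [reassoc_of% (d a).fac, f.naturality]
  let φ := MorphismProperty.factorizationData L R (pushout.desc _ _ comm)
  let m (a : Quiver.Costar i) : (d a).Z ⟶ φ.Z :=
    Sigma.ι (fun a => (d a).Z) a ≫ pushout.inr _ _ ≫ φ.i
  have hm : Sigma.desc m = pushout.inr _ _ ≫ φ.i := Sigma.hom_ext _ _ fun a => Sigma.ι_desc _ _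
  have hφ : phi F i ≫ pushout.inl _ _ ≫ φ.i =
      (Limits.Sigma.map fun a => (d a).i) ≫ Sigma.desc m := by
    rw [hm, pushout.condition_assoc]
  refine ⟨⟨φ.Z, pushout.inl _ _ ≫ φ.i, φ.p, ?_, trivial, φ.hp⟩, m, hφ, ?_, fun a => ?_⟩
  · rw [Category.assoc, φ.fac, pushout.inl_desc]
  · have : pushout.desc _ _ hφ = φ.i :=
      pushout.hom_ext (pushout.inl_desc _ _ _) ((pushout.inr_desc _ _ _).trans hm)
    simpa only [this] using φ.hi
  · rw [Category.assoc, Category.assoc, φ.fac, pushout.inr_desc, Sigma.ι_desc]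

lemma nonempty_mapFactorizationData_latching [L.HasFactorization R]
    (hQ : WellFounded (arrowRel Q)) {F G : Rep Q A} (f : F ⟶ G) :
    Nonempty ((latching L).MapFactorizationData (R.functorCategory (Paths Q)) f) := by
  obtain ⟨d, hd⟩ := exists_forall_of_wellFounded hQ fun i d =>
    exists_vertexFactorization (L := L) (R := R) f i fun a => d a.1 ⟨a.2⟩
  choose m comm hL hm using hd
  let E : Rep Q A := Paths.lift { obj i := (d i).Z, map a := m _ ⟨_, a⟩ }
  have hE {j i : Q} (a : j ⟶ i) : E.arrow a = m i ⟨j, a⟩ := Paths.lift_toPath _ a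
  have hphi (i : Q) : phi E i = Limits.Sigma.desc (m i) :=
    congrArg Limits.Sigma.desc <| funext fun (a : Quiver.Costar i) => hE a.2
  let η : F ⟶ E := Paths.liftNatTrans (fun i => (d i).i) fun {j i} a =>
    (phi_comp_eq_iff.1 (comm i) ⟨j, a⟩).trans (congrArg _ (hE a).symm)
  let π : E ⟶ G := Paths.liftNatTrans (fun i => (d i).p) fun {j i} a =>
    (congrArg (· ≫ _) (hE a)).trans (hm i ⟨j, a⟩)
  refine ⟨{ Z := E, i := η, p := π, fac := Rep.hom_ext fun i => (d i).fac,
            hi := fun i => ?_, hp := fun i => (d i).hp }⟩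
  have : latchingMap η i = pushout.desc _ _ (comm i) :=
    pushout.hom_ext ((inl_latchingMap η i).trans (pushout.inl_desc _ _ _).symm)
      ((inr_latchingMap η i).trans ((hphi i).trans (pushout.inr_desc _ _ _).symm))
  exact this ▸ hL i

variable (Q L R) in
theorem isWeakFactorizationSystem_latching [L.IsWeakFactorizationSystem R]
    (hQ : WellFounded (arrowRel Q)) :
    (latching L).IsWeakFactorizationSystem (R.functorCategory (Paths Q)) := by
  have : L.IsStableUnderRetracts := MorphismProperty.llp_eq_of_wfs L R ▸ inferInstance
  have : R.IsStableUnderRetracts := MorphismProperty.rlp_eq_of_wfs L R ▸ inferInstance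
  have : (latching L).HasFactorization (R.functorCategory (Paths Q)) :=
    ⟨nonempty_mapFactorizationData_latching hQ⟩
  exact .mk' _ _ fun η π hη hπ => hasLiftingProperty_of_latchingMap hQ fun i =>
    MorphismProperty.hasLiftingProperty_of_wfs _ _ (hη i) (hπ ((Paths.of Q).obj i))

lemma latching_le_monomorphisms [(MorphismProperty.monomorphisms A).IsStableUnderCobaseChange]
    [MorphismProperty.IsStableUnderCoproducts.{w} (MorphismProperty.monomorphisms A)]
    (hQ : WellFounded (arrowRel Q)) (hL : L ≤ MorphismProperty.monomorphisms A) :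
    latching L ≤ MorphismProperty.monomorphisms (Rep Q A) := by
  intro F G η hη
  have mono_appAt (i : Q) : Mono (Rep.appAt η i) := by
    induction i using hQ.induction with
    | h i ih =>
      have (a : Quiver.Costar i) : Mono (Rep.appAt η a.1) := ih a.1 ⟨a.2⟩
      have : Mono (pushout.inl (phi F i) (sigmaAt η i)) :=
        (MorphismProperty.monomorphisms A).of_isPushout
          (IsPushout.of_hasPushout (phi F i) (sigmaAt η i)) (inferInstance : Mono (sigmaAt η i))
      have : Mono (latchingMap η i) := hL _ (hη i)
      rw [← inl_latchingMap]
      infer_instance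
  have (i : Paths Q) : Mono (η.app i) := mono_appAt i
  exact NatTrans.mono_of_mono_app η

end Latching

section Phi

open ZeroObject

variable {Q : Type w} [Quiver.{w} Q] {A : Type u} [Category.{v} A] [Abelian A]

lemma functorCategory_epiWithKernel (Y : ObjectProperty A) [Y.IsClosedUnderIsomorphisms] :
    (epiWithKernel Y).functorCategory (Paths Q) = epiWithKernel (repIn Q Y) := by
  ext F G π
  have kernel_at_iff (_ : Epi π) (i : Paths Q) :
      epiWithKernel Y (π.app i) ↔ Y ((kernel π).obj i) :=
    epiWithKernel_g_iff ((shortExact_kernel π).map_of_exact ((evaluation (Paths Q) A).obj i))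
  refine ⟨fun h => ?_, fun ⟨_, h⟩ i => (kernel_at_iff ‹_› i).2 (h i)⟩
  have (i : Paths Q) : Epi (π.app i) := (h i).1
  have : Epi π := NatTrans.epi_of_epi_app π
  exact ⟨this, fun i => (kernel_at_iff this _).1 (h _)⟩

instance (Y : ObjectProperty A) [Y.IsClosedUnderIsomorphisms] :
    (repIn Q Y).IsClosedUnderIsomorphisms where
  of_iso e h i := Y.prop_of_iso (e.app _) (h i)

variable [HasCoproducts.{w} A]

lemma latching_zero_iff (L : MorphismProperty A) [L.RespectsIso] (F : Rep Q A) :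
    latching L (0 : 0 ⟶ F) ↔ ∀ i, L (phi F i) := by
  have isZero_at (i : Q) : IsZero (Rep.at (0 : Rep Q A) i) :=
    ((evaluation (Paths Q) A).obj _).map_isZero (isZero_zero _)
  refine forall_congr' fun i => ?_
  have isZero_sigma : IsZero (∐ fun a : Quiver.Costar i => Rep.at (0 : Rep Q A) a.1) :=
    (IsZero.iff_id_eq_zero _).2 (Sigma.hom_ext _ _ fun a => (isZero_at a.1).eq_of_src _ _)
  have : IsIso (phi (0 : Rep Q A) i) := isZero_sigma.isIso (isZero_at i) _
  rw [← inr_latchingMap (0 : 0 ⟶ F), L.cancel_left_of_respectsIso]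

theorem isCompleteCotorsionPair_phi_repIn {X Y : ObjectProperty A}
    [MorphismProperty.IsStableUnderCoproducts.{w} (MorphismProperty.monomorphisms A)]
    (h : IsCompleteCotorsionPair X Y) (hQ : WellFounded (arrowRel Q)) :
    IsCompleteCotorsionPair (Phi Q X) (repIn Q Y) := by
  have := h.isClosedUnderIsomorphisms_left
  have := h.isClosedUnderIsomorphisms_right
  have := h.isWeakFactorizationSystem
  have : (latching (Q := Q) (monoWithCokernel X)).IsWeakFactorizationSystem
      (epiWithKernel (repIn Q Y)) :=
    functorCategory_epiWithKernel (Q := Q) Y ▸ isWeakFactorizationSystem_latching Q _ _ hQ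
  have leftPerp_eq : leftPerp (repIn Q Y) = Phi Q X := by
    ext F
    exact (leftPerp_iff_of_isWeakFactorizationSystem (L := latching (monoWithCokernel X)) F).trans
      (latching_zero_iff _ F)
  exact leftPerp_eq ▸ isCompleteCotorsionPair_leftPerp
    (latching_le_monomorphisms (L := monoWithCokernel X) hQ fun _ _ _ hf => hf.1)

end Phi

/-! ### Duality -/

section Opposite

open Opposite

section

variable {C : Type*} [Category* C] (L R : MorphismProperty C) [L.IsWeakFactorizationSystem R]

lemma isWeakFactorizationSystem_op : R.op.IsWeakFactorizationSystem L.op := by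
  have : L.IsStableUnderRetracts := MorphismProperty.llp_eq_of_wfs L R ▸ inferInstance
  have : R.IsStableUnderRetracts := MorphismProperty.rlp_eq_of_wfs L R ▸ inferInstance
  exact .mk' _ _ fun i p hi hp =>
    (MorphismProperty.hasLiftingProperty_of_wfs p.unop i.unop hp hi).op

lemma isWeakFactorizationSystem_inverseImage {D : Type*} [Category* D] (F : D ⥤ C)
    [F.IsEquivalence] : (L.inverseImage F).IsWeakFactorizationSystem (R.inverseImage F) := by
  have : L.IsStableUnderRetracts := MorphismProperty.llp_eq_of_wfs L R ▸ inferInstance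
  have : R.IsStableUnderRetracts := MorphismProperty.rlp_eq_of_wfs L R ▸ inferInstance
  have : (L.inverseImage F).HasFactorization (R.inverseImage F) := ⟨fun f => by
    let φ := MorphismProperty.factorizationData L R (F.map f)
    let e := F.objObjPreimageIso φ.Z
    exact ⟨{
      Z := F.objPreimage φ.Z
      i := F.preimage (φ.i ≫ e.inv)
      p := F.preimage (e.hom ≫ φ.p)
      fac := F.map_injective (by simp)
      hi := by simpa [L.cancel_right_of_respectsIso] using φ.hi
      hp := by simpa [R.cancel_left_of_respectsIso] using φ.hp }⟩⟩
  exact .mk' _ _ fun i p hi hp => (F.hasLiftingProperty_iff_of_isEquivalence i p).1 <|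
    MorphismProperty.hasLiftingProperty_of_wfs _ _ hi hp

end

section

variable {C : Type u} [Category.{v} C] [Abelian C] {X Y : ObjectProperty C}

lemma monoWithCokernel_op [Y.IsClosedUnderIsomorphisms] :
    monoWithCokernel Y.op = (epiWithKernel Y).op := by
  ext M N f
  exact ⟨fun ⟨_, h⟩ => (epiWithKernel_g_iff (shortExact_cokernel f).unop).2 h,
    fun ⟨_, h⟩ => (monoWithCokernel_f_iff (shortExact_kernel f.unop).op).2 h⟩

lemma epiWithKernel_op [X.IsClosedUnderIsomorphisms] :
    epiWithKernel X.op = (monoWithCokernel X).op := by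
  ext M N f
  exact ⟨fun ⟨_, h⟩ => (monoWithCokernel_f_iff (shortExact_kernel f).unop).2 h,
    fun ⟨_, h⟩ => (epiWithKernel_g_iff (shortExact_cokernel f.unop).op).2 h⟩

section

variable {D : Type*} [Category* D] [Abelian D] (F : D ⥤ C) [F.IsEquivalence]

lemma monoWithCokernel_inverseImage [X.IsClosedUnderIsomorphisms] :
    monoWithCokernel (X.inverseImage F) = (monoWithCokernel X).inverseImage F := by
  ext M N f
  have (_ : Mono f) := monoWithCokernel_f_iff (X := X) ((shortExact_cokernel f).map_of_exact F)
  exact ⟨fun ⟨hf, h⟩ => (this hf).2 h,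
    fun h => have hf := F.mono_of_mono_map h.1; ⟨hf, (this hf).1 h⟩⟩

lemma epiWithKernel_inverseImage [Y.IsClosedUnderIsomorphisms] :
    epiWithKernel (Y.inverseImage F) = (epiWithKernel Y).inverseImage F := by
  ext M N f
  have (_ : Epi f) := epiWithKernel_g_iff (Y := Y) ((shortExact_kernel f).map_of_exact F)
  exact ⟨fun ⟨hf, h⟩ => (this hf).2 h,
    fun h => have hf := F.epi_of_epi_map h.1; ⟨hf, (this hf).1 h⟩⟩

end

namespace IsCompleteCotorsionPair

protected lemma op (h : IsCompleteCotorsionPair X Y) : IsCompleteCotorsionPair Y.op X.op := by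
  have := h.isClosedUnderIsomorphisms_left
  have := h.isClosedUnderIsomorphisms_right
  have := h.isWeakFactorizationSystem
  have : (monoWithCokernel Y.op).IsWeakFactorizationSystem (epiWithKernel X.op) := by
    rw [monoWithCokernel_op, epiWithKernel_op]
    exact isWeakFactorizationSystem_op _ _
  exact isCompleteCotorsionPair_of_isWeakFactorizationSystem _ _

lemma inverseImage (h : IsCompleteCotorsionPair X Y) {D : Type*} [Category* D] [Abelian D]
    (F : D ⥤ C) [F.IsEquivalence] :
    IsCompleteCotorsionPair (X.inverseImage F) (Y.inverseImage F) := by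
  have := h.isClosedUnderIsomorphisms_left
  have := h.isClosedUnderIsomorphisms_right
  have := h.isWeakFactorizationSystem
  have : (monoWithCokernel (X.inverseImage F)).IsWeakFactorizationSystem
      (epiWithKernel (Y.inverseImage F)) := by
    rw [monoWithCokernel_inverseImage, epiWithKernel_inverseImage]
    exact isWeakFactorizationSystem_inverseImage _ _ F
  exact isCompleteCotorsionPair_of_isWeakFactorizationSystem _ _

end IsCompleteCotorsionPair

end

section

variable (Q : Type w) [Quiver.{w} Q]

/-- Reversal of paths, from the path category of the opposite quiver. -/
def pathsOp : Paths Qᵒᵖ ⥤ (Paths Q)ᵒᵖ :=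
  Paths.lift
    { obj i := op ((Paths.of Q).obj i.unop)
      map a := ((Paths.of Q).map a.unop).op }

/-- Reversal of paths, towards the path category of the opposite quiver. -/
def pathsOpInv : Paths Q ⥤ (Paths Qᵒᵖ)ᵒᵖ :=
  Paths.lift
    { obj i := op ((Paths.of Qᵒᵖ).obj (op i))
      map a := ((Paths.of Qᵒᵖ).map a.op).op }

variable {Q} in
lemma pathsOp_map {i j : Qᵒᵖ} (a : i ⟶ j) :
    (pathsOp Q).map ((Paths.of Qᵒᵖ).map a) = ((Paths.of Q).map a.unop).op :=
  Paths.lift_toPath _ a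

variable {Q} in
lemma pathsOpInv_map {i j : Q} (a : i ⟶ j) :
    (pathsOpInv Q).map ((Paths.of Q).map a) = ((Paths.of Qᵒᵖ).map a.op).op :=
  Paths.lift_toPath _ a

/-- The path category of the opposite quiver is the opposite of the path category. -/
def pathsOpEquivalence : Paths Qᵒᵖ ≌ (Paths Q)ᵒᵖ where
  functor := pathsOp Q
  inverse := (pathsOpInv Q).leftOp
  unitIso := Paths.liftNatIso (fun _ => Iso.refl _) fun {i j} a => by
    refine (Category.comp_id _).trans (Eq.trans ?_ (Category.id_comp _).symm)
    exact (congrArg Quiver.Hom.unop ((congrArg ((pathsOpInv Q).map ·.unop) (pathsOp_map a)).trans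
      (pathsOpInv_map a.unop))).symm
  counitIso := NatIso.op (Paths.liftNatIso (F := 𝟭 _) (G := pathsOpInv Q ⋙ (pathsOp Q).leftOp)
    (fun _ => Iso.refl _) fun {i j} a => by
    refine (Category.comp_id _).trans (Eq.trans ?_ (Category.id_comp _).symm)
    exact (congrArg Quiver.Hom.unop ((congrArg ((pathsOp Q).map ·.unop) (pathsOpInv_map a)).trans
      (pathsOp_map a.op))).symm)

variable (A : Type u) [Category.{v} A]

/-- A representation of `Q` in `A` as a representation of `Qᵒᵖ` in `Aᵒᵖ`. The opposite category is
placed on the target, so that inverse images along this functor live on `Rep Q A`. -/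
def repOp : Rep Q A ⥤ (Rep Qᵒᵖ Aᵒᵖ)ᵒᵖ :=
  (Functor.opHom (Paths Q) A ⋙ (Functor.whiskeringLeft _ _ _).obj (pathsOp Q)).rightOp

instance : (pathsOp Q).IsEquivalence :=
  (pathsOpEquivalence Q).isEquivalence_functor

instance : (Functor.opHom (Paths Q) A).IsEquivalence :=
  (Functor.opUnopEquiv _ _).isEquivalence_functor

instance : (repOp Q A).IsEquivalence :=
  inferInstanceAs (Functor.rightOp
    (Functor.opHom (Paths Q) A ⋙ (Functor.whiskeringLeft _ _ _).obj (pathsOp Q))).IsEquivalence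

end

section

variable {Q : Type w} [Quiver.{w} Q] {A : Type u} [Category.{v} A]

lemma repOp_arrow (F : Rep Q A) {i j : Qᵒᵖ} (a : i ⟶ j) :
    Rep.arrow ((repOp Q A).obj F).unop a = (F.arrow a.unop).op :=
  congrArg (F.op.map ·) (pathsOp_map a)

/-- The arrows of `Qᵒᵖ` with target `i` are the arrows of `Q` with source `i`. -/
def costarEquivStar (i : Qᵒᵖ) : Quiver.Costar i ≃ Quiver.Star i.unop where
  toFun a := ⟨a.1.unop, a.2.unop⟩
  invFun a := ⟨op a.1, a.2.op⟩

variable [HasProducts.{w} A]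

/-- The coproduct on which `phi` is defined for `repOp` is the product in which `psi` takes its
values. -/
def psiIso (F : Rep Q A) (i : Qᵒᵖ) :
    (∐ fun a : Quiver.Costar i => Rep.at ((repOp Q A).obj F).unop a.1) ≅
      op (∏ᶜ fun a : Quiver.Star i.unop => F.at a.1) :=
  Sigma.reindex (costarEquivStar i) (fun a => op (F.at a.1)) ≪≫
    (opProductIsoCoproduct fun a : Quiver.Star i.unop => F.at a.1).symm

lemma ι_psiIso_hom (F : Rep Q A) {i : Qᵒᵖ} (a : Quiver.Costar i) :
    Sigma.ι (fun a : Quiver.Costar i => Rep.at ((repOp Q A).obj F).unop a.1) a ≫ (psiIso F i).hom =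
      (Pi.π (fun a : Quiver.Star i.unop => F.at a.1) (costarEquivStar i a)).op :=
  (Sigma.ι_reindex_hom_assoc (costarEquivStar i) (fun a => op (F.at a.1)) a _).trans <|
    (Iso.comp_inv_eq _).2 (π_comp_opProductIsoCoproduct_hom _ _).symm

lemma psiIso_hom_comp (F : Rep Q A) (i : Qᵒᵖ) :
    (psiIso F i).hom ≫ (psi F i.unop).op = phi ((repOp Q A).obj F).unop i := by
  refine Sigma.hom_ext _ _ fun a => ?_
  have ι_comp : Sigma.ι _ a ≫ (psiIso F i).hom ≫ (psi F i.unop).op = (F.arrow a.2.unop).op := by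
    rw [← Category.assoc, ι_psiIso_hom]
    exact congrArg Quiver.Hom.op (Pi.lift_π _ (costarEquivStar i a))
  exact ι_comp.trans ((repOp_arrow F a.2).symm.trans (ι_phi _ a).symm)

end

section

variable {A : Type u} [Category.{v} A] [HasProducts.{w} A]

lemma opProductIsoCoproduct_inv_comp_map_comp {J : Type w} {Z W : J → A} (g : ∀ j, Z j ⟶ W j) :
    (opProductIsoCoproduct W).inv ≫ (Limits.Pi.map g).op ≫ (opProductIsoCoproduct Z).hom =
      Limits.Sigma.map fun j => (g j).op := by
  have : Limits.Pi.map g = Pi.lift fun j => Pi.π Z j ≫ g j := Pi.hom_ext _ _ fun j => by simp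
  refine Sigma.hom_ext _ _ fun j => ?_
  rw [this, ← Category.assoc (opProductIsoCoproduct W).inv, opProductIsoCoproduct_inv_comp_lift,
    Sigma.ι_desc_assoc, op_comp, Category.assoc, π_comp_opProductIsoCoproduct_hom, Sigma.ι_map]

instance [Abelian A] [AB4StarOfSize.{w} A] :
    MorphismProperty.IsStableUnderCoproducts.{w} (MorphismProperty.monomorphisms Aᵒᵖ) where
  isStableUnderCoproductsOfShape J := by
    refine .mk _ _ fun M N _ _ f hf => ?_
    let α : Discrete.functor (fun j => (N j).unop) ⟶ Discrete.functor (fun j => (M j).unop) :=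
      Discrete.natTrans fun j => (f j.as).unop
    have (j : J) : Mono (f j) := hf j
    have (j : Discrete J) : Epi (α.app j) := inferInstanceAs (Epi (f j.as).unop)
    have : Epi α := NatTrans.epi_of_epi_app α
    have : Epi (Limits.Pi.map fun j => (f j).unop) := inferInstanceAs (Epi (lim.map α))
    refine (?_ : Mono (Limits.Sigma.map fun j => (f j).unop.op))
    rw [← opProductIsoCoproduct_inv_comp_map_comp]
    infer_instance

variable {Q : Type w} [Quiver.{w} Q] [Abelian A]

lemma phi_repOp_iff {Y : ObjectProperty A} [Y.IsClosedUnderIsomorphisms] (F : Rep Q A) :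
    Phi Qᵒᵖ Y.op ((repOp Q A).obj F).unop ↔ Psi Q Y F := by
  have (i : Qᵒᵖ) : monoWithCokernel Y.op (phi ((repOp Q A).obj F).unop i) ↔
      epiWithKernel Y (psi F i.unop) := by
    rw [← psiIso_hom_comp]
    refine ((monoWithCokernel Y.op).cancel_left_of_respectsIso _ _).trans ?_
    rw [monoWithCokernel_op]
    rfl
  exact ⟨fun h i => (this (op i)).1 (h _), fun h i => (this i).2 (h _)⟩

theorem isCompleteCotorsionPair_repIn_psi [AB4StarOfSize.{w} A] {X Y : ObjectProperty A}
    (h : IsCompleteCotorsionPair X Y) (hQ : WellFounded (arrowRel Qᵒᵖ)) :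
    IsCompleteCotorsionPair (repIn Q X) (Psi Q Y) := by
  have := h.isClosedUnderIsomorphisms_right
  have repIn_eq : (repIn Qᵒᵖ X.op).op.inverseImage (repOp Q A) = repIn Q X := by
    ext F
    exact ⟨fun h i => h (op i), fun h i => h i.unop⟩
  have phi_eq : (Phi Qᵒᵖ Y.op).op.inverseImage (repOp Q A) = Psi Q Y := by
    ext F
    exact phi_repOp_iff F
  exact repIn_eq ▸ phi_eq ▸ (isCompleteCotorsionPair_phi_repIn h.op hQ).op.inverseImage (repOp Q A)

end

end Opposite

end QuiverCotorsion

end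

theorem mainTheorem3 {A : Type u} [Category.{v} A] [Abelian A] (Q : Type w) [Quiver.{w} Q]
    (X Y : ObjectProperty A) (hXY : QuiverCotorsion.IsCompleteCotorsionPair X Y) :
    (∀ [HasCoproducts.{w} A] [AB4OfSize.{w} A], QuiverCotorsion.IsLeftRooted Q →
      QuiverCotorsion.IsCompleteCotorsionPair
        (QuiverCotorsion.Phi Q X) (QuiverCotorsion.repIn Q Y)) ∧
    (∀ [HasProducts.{w} A] [AB4StarOfSize.{w} A], QuiverCotorsion.IsRightRooted Q →
      QuiverCotorsion.IsCompleteCotorsionPair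
        (QuiverCotorsion.repIn Q X) (QuiverCotorsion.Psi Q Y)) :=
  ⟨fun hQ => QuiverCotorsion.isCompleteCotorsionPair_phi_repIn hXY hQ.wellFounded_arrowRel,
    fun hQ => QuiverCotorsion.isCompleteCotorsionPair_repIn_psi hXY
      (QuiverCotorsion.IsLeftRooted.wellFounded_arrowRel hQ)⟩
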